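/- There are absolute constants $c, C > 0$ such that the following holds. Let $1 \le k \le d$ and $n \ge 1$ be integers, and let $\mathcal{G}_{k,d}$ be the Grassmann space of $k$-dimensional linear subspaces of $\mathbb{R}^d$, equipped with the probability measure $\sigma_k$ induced by the Haar measure on the orthogonal group $O(\mathbb{R}^d)$ (that is, the distribution of $gV_0$, where $g$ is Haar distributed on $O(\mathbb{R}^d)$ and $V_0$ is a fixed $k$-dimensional subspace). Let $V_1,\dots,V_n$ be independent random elements of $\mathcal{G}_{k,d}$, each with distribution $\sigma_k$, let $P_{V_j}\in\mathbb{R}^{d\times d}$ be the matrix of the orthogonal projector onto $V_j$, and let $$P := \sqrt{\tfrac{d}{k}}\,\bigl(P_{V_1},\dots,P_{V_n}\bigr)^{*}\in\mathbb{R}^{nd\times d}$$ be the matrix obtained by stacking the blocks $\sqrt{d/k}\,P_{V_j}$ on top of each other (so the blocks are independent, whereas the rows within a block may be dependent). Let $s_{\min}(P)$ and $s_{\max}(P)$ denote the smallest and the largest of its $d$ singular values, i.e. of the square roots of the eigenvalues of $P^*P$. Then, for every $t \ge 0$, with probability at least $1-2\exp(-ct^2)$, $$\sqrt{n}-C\sqrt{d}-t\;\le\;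 s_{\min}(P)\;\le\; s_{\max}(P)\;\le\;\sqrt{n}+C\sqrt{d}+t .$$ -/

import Mathlib

open MeasureTheory ProbabilityTheory

noncomputable section

/-- The real Grassmann space: the `k`-dimensional linear subspaces of Euclidean space `ℝ^d`. -/
def RealGrassmannian (k d : ℕ) : Type :=
  {V : Submodule ℝ (EuclideanSpace ℝ (Fin d)) // Module.finrank ℝ V = k}

namespace RealGrassmannian

variable {k d : ℕ}

/-- The matrix `P_V ∈ ℝ^{d × d}`, in the standard basis, of the orthogonal projector of `ℝ^d`
onto `V`. -/
def projMatrix (V : RealGrassmannian k d) : Matrix (Fin d) (Fin d) ℝ :=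
  Matrix.toEuclideanLin.symm (V.1.starProjection : EuclideanSpace ℝ (Fin d) →ₗ[ℝ] _)

/-- A subspace is identified with its orthogonal projector, which gives the Grassmann space its
usual topology. -/
instance : TopologicalSpace (RealGrassmannian k d) :=
  TopologicalSpace.induced projMatrix inferInstance

/-- The Grassmann space carries its Borel sigma-algebra. -/
instance : MeasurableSpace (RealGrassmannian k d) := borel _

instance : BorelSpace (RealGrassmannian k d) := ⟨rfl⟩

theorem continuous_projMatrix :
    Continuous (projMatrix : RealGrassmannian k d → Matrix (Fin d) (Fin d) ℝ) :=
  continuous_induced_dom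

end RealGrassmannian

/-- The orthogonal group `O(ℝ^d)` carries its Borel sigma-algebra. -/
instance orthogonalGroupMeasurableSpace (d : ℕ) :
    MeasurableSpace (Matrix.orthogonalGroup (Fin d) ℝ) := borel _

instance orthogonalGroupBorelSpace (d : ℕ) :
    BorelSpace (Matrix.orthogonalGroup (Fin d) ℝ) := ⟨rfl⟩

instance orthogonalGroupCompactSpace (d : ℕ) :
    CompactSpace (Matrix.orthogonalGroup (Fin d) ℝ) := by
  refine isCompact_iff_compactSpace (s := (Matrix.orthogonalGroup (Fin d) ℝ :
    Set (Matrix (Fin d) (Fin d) ℝ))).mp ?_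
  have hK : IsCompact (Set.pi Set.univ (fun _ : Fin d =>
      Set.pi Set.univ (fun _ : Fin d => Set.Icc (-1 : ℝ) 1))) :=
    isCompact_univ_pi fun _ => isCompact_univ_pi fun _ => isCompact_Icc
  refine hK.of_isClosed_subset (isClosed_unitary (R := Matrix (Fin d) (Fin d) ℝ)) ?_
  intro A hA i _ j _
  exact abs_le.mp (entry_norm_bound_of_unitary (𝕜 := ℝ) hA i j)

/-- The Haar measure on the orthogonal group `O(ℝ^d)`, normalized to total mass one. -/
def orthogonalHaar (d : ℕ) : Measure (Matrix.orthogonalGroup (Fin d) ℝ) :=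
  Measure.haarMeasure ⊤

instance (d : ℕ) : IsProbabilityMeasure (orthogonalHaar d) :=
  ⟨by simpa [orthogonalHaar] using
    Measure.haarMeasure_self (K₀ := (⊤ : TopologicalSpace.PositiveCompacts
      (Matrix.orthogonalGroup (Fin d) ℝ)))⟩

/-- The linear isometry `x ↦ g x` of `ℝ^d` given by an orthogonal matrix `g`. -/
def orthogonalIsometry {d : ℕ} (g : Matrix.orthogonalGroup (Fin d) ℝ) :
    EuclideanSpace ℝ (Fin d) →ₗᵢ[ℝ] EuclideanSpace ℝ (Fin d) where
  toLinearMap := Matrix.toEuclideanLin (g : Matrix (Fin d) (Fin d) ℝ)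
  norm_map' x := by
    have h : (g : Matrix (Fin d) (Fin d) ℝ).transpose * g = 1 := Unitary.coe_star_mul_self g
    have h2 : ‖Matrix.toEuclideanLin (g : Matrix (Fin d) (Fin d) ℝ) x‖ ^ 2 = ‖x‖ ^ 2 := by
      rw [← real_inner_self_eq_norm_sq, ← real_inner_self_eq_norm_sq,
        EuclideanSpace.inner_eq_star_dotProduct, EuclideanSpace.inner_eq_star_dotProduct]
      change (g : Matrix (Fin d) (Fin d) ℝ).mulVec x.ofLp ⬝ᵥ
        (g : Matrix (Fin d) (Fin d) ℝ).mulVec x.ofLp = x.ofLp ⬝ᵥ x.ofLp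
      rw [Matrix.dotProduct_mulVec, Matrix.vecMul_mulVec, h, Matrix.vecMul_one]
    exact (sq_eq_sq₀ (norm_nonneg _) (norm_nonneg _)).mp h2

namespace RealGrassmannian

variable {k d : ℕ}

/-- The action `V ↦ gV` of the orthogonal group on the Grassmann space. -/
def rotate (g : Matrix.orthogonalGroup (Fin d) ℝ) (V : RealGrassmannian k d) :
    RealGrassmannian k d :=
  ⟨V.1.map (orthogonalIsometry g).toLinearMap,
    (LinearEquiv.finrank_eq (Submodule.equivMapOfInjective _
      (orthogonalIsometry g).injective V.1)).symm.trans V.2⟩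

/-- The coordinate subspace spanned by the first `k` standard basis vectors of `ℝ^d`. -/
def coordinate (hk : k ≤ d) : RealGrassmannian k d :=
  ⟨Submodule.span ℝ (Set.range fun i : Fin k =>
      EuclideanSpace.basisFun (Fin d) ℝ (Fin.castLE hk i)), by
    exact (finrank_span_eq_card
      (((EuclideanSpace.basisFun (Fin d) ℝ).orthonormal.linearIndependent).comp _
        (Fin.castLE_injective hk))).trans (Fintype.card_fin k)⟩

/-- The projector onto `gV` is `g P_V gᵀ`. -/
theorem projMatrix_rotate (g : Matrix.orthogonalGroup (Fin d) ℝ) (V : RealGrassmannian k d) :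
    (rotate g V).projMatrix =
      (g : Matrix (Fin d) (Fin d) ℝ) * V.projMatrix * star (g : Matrix (Fin d) (Fin d) ℝ) := by
  have h : (g : Matrix (Fin d) (Fin d) ℝ) * star (g : Matrix (Fin d) (Fin d) ℝ) = 1 :=
    Unitary.coe_mul_star_self g
  apply Matrix.toEuclideanLin.injective
  refine LinearMap.ext fun x => ?_
  have hx : orthogonalIsometry g (Matrix.toEuclideanLin
      (star (g : Matrix (Fin d) (Fin d) ℝ)) x) = x := by
    change WithLp.toLp 2 ((g : Matrix (Fin d) (Fin d) ℝ).mulVec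
      ((star (g : Matrix (Fin d) (Fin d) ℝ)).mulVec x.ofLp)) = x
    rw [Matrix.mulVec_mulVec, h, Matrix.one_mulVec]
  have hmul : ∀ (A B : Matrix (Fin d) (Fin d) ℝ) (y : EuclideanSpace ℝ (Fin d)),
      Matrix.toEuclideanLin (A * B) y = Matrix.toEuclideanLin A (Matrix.toEuclideanLin B y) :=
    fun A B y => congrArg (WithLp.toLp 2) (Matrix.mulVec_mulVec y.ofLp A B).symm
  have key := (orthogonalIsometry g).map_starProjection' V.1
    (Matrix.toEuclideanLin (star (g : Matrix (Fin d) (Fin d) ℝ)) x)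
  rw [hx] at key
  rw [hmul, hmul, projMatrix, projMatrix, LinearEquiv.apply_symm_apply,
    LinearEquiv.apply_symm_apply]
  exact key.symm

/-- The map `g ↦ gV` is continuous, so pushing a measure forward along it is meaningful. -/
theorem continuous_rotate (V : RealGrassmannian k d) :
    Continuous fun g : Matrix.orthogonalGroup (Fin d) ℝ => rotate g V := by
  refine continuous_induced_rng.mpr ?_
  have : (projMatrix ∘ fun g : Matrix.orthogonalGroup (Fin d) ℝ => rotate g V) =
      fun g : Matrix.orthogonalGroup (Fin d) ℝ => (g : Matrix (Fin d) (Fin d) ℝ) * V.projMatrix * star (g : Matrix (Fin d) (Fin d) ℝ) :=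
    funext fun g => projMatrix_rotate g V
  rw [this]
  exact (continuous_subtype_val.mul continuous_const).mul continuous_subtype_val.star

/-- The probability measure `σ_k` on the Grassmann space that the Haar measure on `O(ℝ^d)` induces:
the law of `gV₀` for a Haar distributed `g` and the coordinate subspace `V₀`. As the orthogonal
group acts transitively, the choice of `V₀` plays no role. -/
def haar (hk : k ≤ d) : Measure (RealGrassmannian k d) :=
  (orthogonalHaar d).map fun g => rotate g (coordinate hk)

instance (hk : k ≤ d) : IsProbabilityMeasure (haar hk) :=
  Measure.isProbabilityMeasure_map (continuous_rotate _).measurable.aemeasurable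

/-- The matrix `P = √(d/k) (P_{V_1}, …, P_{V_n})^* ∈ ℝ^{nd × d}`, whose rows are indexed by pairs
(block number, row number in the block). -/
def stackedProj {n : ℕ} (V : Fin n → RealGrassmannian k d) :
    Matrix (Fin n × Fin d) (Fin d) ℝ :=
  Matrix.of fun p b => √((d : ℝ) / k) * (V p.1).projMatrix p.2 b

end RealGrassmannian

/-- The largest singular value of a real matrix; Mathlib lists the singular values of a linear map
in decreasing order, starting from index zero. -/
def Matrix.sMax {m n : Type*} [Fintype m] [Fintype n] [DecidableEq n] (A : Matrix m n ℝ) : ℝ :=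
  (Matrix.toEuclideanLin A).singularValues 0

/-- The smallest singular value of a real matrix with `N` columns: the last one of the `N` square
roots of the eigenvalues of `Aᵀ A`, counted with multiplicity. -/
def Matrix.sMin {m n : Type*} [Fintype m] [Fintype n] [DecidableEq n] (A : Matrix m n ℝ) : ℝ :=
  (Matrix.toEuclideanLin A).singularValues (Fintype.card n - 1)

end

/-! For a fixed unit vector `x`, `‖P x‖²` is the sum of the `n` independent variables `(d/k)
‖P_{V_j} x‖²`, each of mean one. Their exponential moments are bounded uniformly in `k` and `d`
(`integral_exp_projNormSq_le`): by rotation invariance `x` may be replaced by `ε/√d` for any sign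
vector `ε`, and then one averages over `ε`. For fixed `V` with orthonormal basis `w_i` the variable
becomes the mean over `i` of `⟨w_i, ε⟩²`, so Jensen's inequality reduces to Rademacher sums, which
are dominated by a Gaussian.

The centred variables are therefore sub-exponential, and Bernstein's argument
(`measureReal_sum_projNormSq_le`) controls `‖P x‖² - n` at scale `max (√n a) (a²)`. A union bound
over a `1/2`-net of at most `5 ^ d` points is paid for by `a = C√d + t`. `abs_le_of_forall_net`
extends the estimate to the whole sphere, and `sqrt_bounds_of_abs_sq_sub_le` turns it into `|‖P x‖ -
√n| ≤ a`. -/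

/-! ### Singular values as norms on the unit sphere -/

theorem LinearMap.exists_norm_eq_singularValues {E F : Type*} [NormedAddCommGroup E]
    [InnerProductSpace ℝ E] [FiniteDimensional ℝ E] [NormedAddCommGroup F] [InnerProductSpace ℝ F]
    [FiniteDimensional ℝ F] (T : E →ₗ[ℝ] F) {i : ℕ} (hi : i < Module.finrank ℝ E) :
    ∃ x : E, ‖x‖ = 1 ∧ ‖T x‖ = T.singularValues i := by
  set b := T.isSymmetric_adjoint_comp_self.eigenvectorBasis rfl with hb
  refine ⟨b ⟨i, hi⟩, b.orthonormal.1 _, ?_⟩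
  have h1 : ‖T (b ⟨i, hi⟩)‖ ^ 2 = T.singularValues i ^ 2 := by
    have h2 := T.isSymmetric_adjoint_comp_self.apply_eigenvectorBasis rfl ⟨i, hi⟩
    rw [T.sq_singularValues_of_lt rfl hi, ← real_inner_self_eq_norm_sq,
      ← LinearMap.adjoint_inner_right, ← LinearMap.comp_apply, ← hb] at *
    rw [h2, inner_smul_right, real_inner_self_eq_norm_sq, b.orthonormal.1]
    simp
  exact (sq_eq_sq₀ (norm_nonneg _) (T.singularValues_nonneg i)).mp h1

/-- Both singular values are attained at unit vectors, so no min-max principle is needed. `Nonempty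
n` makes `card n - 1` a genuine index. -/
theorem Matrix.sMin_sMax_bounds {m n : Type*} [Fintype m] [Fintype n] [DecidableEq n] [Nonempty n]
    (A : Matrix m n ℝ) {a b : ℝ}
    (h : ∀ x : EuclideanSpace ℝ n, ‖x‖ = 1 →
      a ≤ ‖Matrix.toEuclideanLin A x‖ ∧ ‖Matrix.toEuclideanLin A x‖ ≤ b) :
    a ≤ A.sMin ∧ A.sMin ≤ A.sMax ∧ A.sMax ≤ b := by
  have hpos : 0 < Fintype.card n := Fintype.card_pos
  refine ⟨?_, (Matrix.toEuclideanLin A).singularValues_antitone (Nat.zero_le _), ?_⟩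
  · obtain ⟨x, hx, hx'⟩ := (Matrix.toEuclideanLin A).exists_norm_eq_singularValues
      (i := Fintype.card n - 1) (by rw [finrank_euclideanSpace]; omega)
    exact (h x hx).1.trans_eq hx'
  · obtain ⟨x, hx, hx'⟩ := (Matrix.toEuclideanLin A).exists_norm_eq_singularValues
      (i := 0) (by rwa [finrank_euclideanSpace])
    exact hx'.symm.trans_le (h x hx).2

/-! ### Nets and quadratic forms -/

/-- The unit sphere has a `1/2`-net of cardinality at most `5 ^ d`. -/
theorem exists_half_net_sphere (E : Type*) [NormedAddCommGroup E] [NormedSpace ℝ E]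
    [FiniteDimensional ℝ E] :
    ∃ s : Finset E, s.card ≤ 5 ^ Module.finrank ℝ E ∧ (∀ y ∈ s, ‖y‖ = 1) ∧
      ∀ x : E, ‖x‖ = 1 → ∃ y ∈ s, ‖x - y‖ ≤ 1 / 2 := by
  classical
  let P : Finset E → Prop := fun s =>
    (∀ y ∈ s, ‖y‖ = 1) ∧ ∀ y ∈ s, ∀ z ∈ s, y ≠ z → 1 / 2 ≤ ‖y - z‖
  have hcard : ∀ s, P s → s.card ≤ 5 ^ Module.finrank ℝ E := by
    rintro s ⟨h1, h2⟩
    -- Doubling gives `1`-separated points of norm at most `2`, the normalization of the Besicovitch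
    -- bound.
    have hinj : Function.Injective fun y : E => (2 : ℝ) • y := smul_right_injective E two_ne_zero
    rw [← Finset.card_image_of_injective s hinj]
    apply Besicovitch.card_le_of_separated
    · intro c hc
      obtain ⟨y, hy, rfl⟩ := Finset.mem_image.mp hc
      simp [norm_smul, h1 y hy]
    · intro c hc c' hc' hne
      obtain ⟨y, hy, rfl⟩ := Finset.mem_image.mp hc
      obtain ⟨z, hz, rfl⟩ := Finset.mem_image.mp hc'
      have := h2 y hy z hz (fun h => hne (by rw [h]))
      rw [← smul_sub, norm_smul, Real.norm_two]
      linarith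
  -- A separated set of maximal cardinality is a net, since a point it misses could be added.
  let S : Set ℕ := {m | ∃ s, P s ∧ s.card = m}
  have hS : S.Nonempty := ⟨0, ∅, by simp [P], rfl⟩
  have hb : BddAbove S := ⟨5 ^ Module.finrank ℝ E, by rintro _ ⟨s, hs, rfl⟩; exact hcard s hs⟩
  obtain ⟨s, hs, hmax⟩ := Nat.sSup_mem hS hb
  refine ⟨s, hcard s hs, hs.1, fun x hx => ?_⟩
  by_contra! hcon
  have hxs : x ∉ s := fun hxs => by
    have := hcon x hxs
    norm_num at this
  have hP : P (insert x s) := by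
    refine ⟨fun y hy => ?_, fun y hy z hz hne => ?_⟩
    · rcases Finset.mem_insert.mp hy with rfl | hy
      exacts [hx, hs.1 y hy]
    · rcases Finset.mem_insert.mp hy with rfl | hy' <;>
        rcases Finset.mem_insert.mp hz with rfl | hz'
      · exact absurd rfl hne
      · exact (hcon z hz').le
      · rw [norm_sub_rev]; exact (hcon y hy').le
      · exact hs.2 y hy' z hz' hne
  have h1 : (insert x s).card ≤ sSup S := le_csSup hb ⟨_, hP, rfl⟩
  rw [Finset.card_insert_of_notMem hxs, hmax] at h1
  omega

/-- A quadratic form that is small on a `1/2`-net of the unit sphere is small on the sphere. -/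
theorem abs_le_of_forall_net {E : Type*} [NormedAddCommGroup E] [InnerProductSpace ℝ E]
    [FiniteDimensional ℝ E] (B : LinearMap.BilinForm ℝ E) (hB : B.IsSymm) {s : Finset E}
    (hs1 : ∀ y ∈ s, ‖y‖ = 1) (hs : ∀ x : E, ‖x‖ = 1 → ∃ y ∈ s, ‖x - y‖ ≤ 1 / 2) {m : ℝ}
    (hm : ∀ y ∈ s, |B y y| ≤ m) {x : E} (hx : ‖x‖ = 1) : |B x x| ≤ 32 * m := by
  have hcont : Continuous fun x : E => |B x x| := by
    have h1 : Continuous fun p : E × E => B p.1 p.2 := by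
      have h2 : Continuous fun p : E × E => (LinearMap.toContinuousLinearMap
        ((LinearMap.toContinuousLinearMap : (E →ₗ[ℝ] ℝ) ≃ₗ[ℝ] (E →L[ℝ] ℝ)).toLinearMap ∘ₗ B)) p.1 p.2 := by
        fun_prop
      exact h2
    exact (h1.comp (continuous_id.prodMk continuous_id)).abs
  obtain ⟨z, hz, hmax⟩ := (isCompact_sphere (0 : E) 1).exists_isMaxOn
    ⟨x, by simpa using hx⟩ hcont.continuousOn
  set M := |B z z| with hM
  have hz1 : ‖z‖ = 1 := by simpa using hz
  have hM0 : 0 ≤ M := abs_nonneg _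
  have hle : ∀ y : E, |B y y| ≤ M * ‖y‖ ^ 2 := by
    intro y
    rcases eq_or_ne y 0 with rfl | hy
    · simp
    have hy' : ‖y‖ ≠ 0 := norm_ne_zero_iff.mpr hy
    have h1 : |B (‖y‖⁻¹ • y) (‖y‖⁻¹ • y)| ≤ M :=
      hmax (by simp [norm_smul, hy'])
    have h2 : B y y = ‖y‖ ^ 2 * B (‖y‖⁻¹ • y) (‖y‖⁻¹ • y) := by
      simp only [map_smul, LinearMap.smul_apply, smul_eq_mul]
      field_simp
    rw [h2, abs_mul, abs_of_nonneg (sq_nonneg ‖y‖), mul_comm]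
    gcongr
  have hsymm : ∀ u v, B u v = B v u := fun u v => hB.eq u v
  have hpol : ∀ u v : E, 2 * |B u v| ≤ M * (‖u‖ ^ 2 + ‖v‖ ^ 2) := by
    intro u v
    have h1 : 4 * B u v = B (u + v) (u + v) - B (u - v) (u - v) := by
      simp only [map_add, map_sub, LinearMap.add_apply, LinearMap.sub_apply]
      linarith [hsymm u v]
    have h2 := parallelogram_law_with_norm ℝ u v
    have h3 := abs_sub (B (u + v) (u + v)) (B (u - v) (u - v))
    rw [← h1, abs_mul, abs_of_pos (by norm_num : (0 : ℝ) < 4)] at h3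
    nlinarith [hle (u + v), hle (u - v)]
  obtain ⟨y, hy, hzy⟩ := hs z hz1
  have hy1 := hs1 y hy
  have hdiff : B z z - B y y = B (z + y) (z - y) := by
    simp only [map_add, map_sub, LinearMap.add_apply]
    linarith [hsymm z y]
  have hpar := parallelogram_law_with_norm ℝ z y
  rw [hz1, hy1] at hpar
  have hkey : |B z z - B y y| ≤ 31 / 32 * M := by
    -- The unequal scaling exploits that `z - y` is short: with `q = ‖z - y‖² ≤ 1/4` the bound is `M
    -- (1 + 15q/4) / 2 ≤ 31M/32`. Without scaling it would be `2M`, which is useless.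
    have h1 := hpol ((1 / 2 : ℝ) • (z + y)) ((2 : ℝ) • (z - y))
    have h2 : B ((1 / 2 : ℝ) • (z + y)) ((2 : ℝ) • (z - y)) = B z z - B y y := by
      rw [hdiff, map_smul, map_smul, LinearMap.smul_apply, smul_eq_mul, smul_eq_mul]
      ring
    rw [h2, norm_smul, norm_smul, mul_pow, mul_pow] at h1
    norm_num at h1
    have hq : ‖z - y‖ ^ 2 ≤ (1 / 2) ^ 2 := pow_le_pow_left₀ (norm_nonneg _) hzy 2
    nlinarith
  have h4 : M - |B y y| ≤ |B z z - B y y| := abs_sub_abs_le_abs_sub _ _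
  have h5 := hm y hy
  have h6 : |B x x| ≤ M := hmax (by simpa using hx)
  linarith

/-! ### Rotation invariance and the mean of the projected norm -/

namespace RealGrassmannian

variable {k d : ℕ}

theorem starProjection_apply_eq (V : RealGrassmannian k d) (x : EuclideanSpace ℝ (Fin d)) :
    V.1.starProjection x = Matrix.toEuclideanLin V.projMatrix x := by
  rw [projMatrix, LinearEquiv.apply_symm_apply]; rfl

/-- The squared norm of the orthogonal projection of `x` onto `V`. -/
noncomputable def projNormSq (V : RealGrassmannian k d) (x : EuclideanSpace ℝ (Fin d)) : ℝ :=
  ‖V.1.starProjection x‖ ^ 2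

theorem projNormSq_nonneg (V : RealGrassmannian k d) (x : EuclideanSpace ℝ (Fin d)) :
    0 ≤ V.projNormSq x := sq_nonneg _

theorem continuous_projNormSq (x : EuclideanSpace ℝ (Fin d)) :
    Continuous fun V : RealGrassmannian k d => V.projNormSq x := by
  have h : Continuous fun V : RealGrassmannian k d =>
      (WithLp.toLp 2 (V.projMatrix.mulVec x.ofLp) : EuclideanSpace ℝ (Fin d)) :=
    (PiLp.continuous_toLp 2 _).comp (continuous_projMatrix.matrix_mulVec continuous_const)
  simp_rw [projNormSq, starProjection_apply_eq]
  exact (h.norm).pow 2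

theorem measurable_projNormSq (x : EuclideanSpace ℝ (Fin d)) :
    Measurable fun V : RealGrassmannian k d => V.projNormSq x :=
  (continuous_projNormSq x).measurable

theorem projNormSq_le (V : RealGrassmannian k d) (x : EuclideanSpace ℝ (Fin d)) :
    V.projNormSq x ≤ ‖x‖ ^ 2 :=
  pow_le_pow_left₀ (norm_nonneg _) (V.1.norm_starProjection_apply_le x) 2

theorem starProjection_rotate_apply (g : Matrix.orthogonalGroup (Fin d) ℝ)
    (V : RealGrassmannian k d) (x : EuclideanSpace ℝ (Fin d)) :
    (rotate g V).1.starProjection (orthogonalIsometry g x) =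
      orthogonalIsometry g (V.1.starProjection x) :=
  ((orthogonalIsometry g).map_starProjection' V.1 x).symm

theorem projNormSq_rotate (g : Matrix.orthogonalGroup (Fin d) ℝ)
    (V : RealGrassmannian k d) (x : EuclideanSpace ℝ (Fin d)) :
    (rotate g V).projNormSq (orthogonalIsometry g x) = V.projNormSq x := by
  rw [projNormSq, starProjection_rotate_apply, LinearIsometry.norm_map, projNormSq]

theorem rotate_rotate (g h : Matrix.orthogonalGroup (Fin d) ℝ) (V : RealGrassmannian k d) :
    rotate g (rotate h V) = rotate (g * h) V := by
  apply Subtype.ext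
  change (V.1.map _).map _ = V.1.map _
  rw [← Submodule.map_comp]
  congr 1
  exact LinearMap.ext fun x => congrArg (WithLp.toLp 2) (Matrix.mulVec_mulVec x.ofLp g.1 h.1)

/-- Left invariance of Haar measure, pushed forward along the orbit map. -/
theorem measurePreserving_rotate (hk : k ≤ d) (h : Matrix.orthogonalGroup (Fin d) ℝ) :
    MeasurePreserving (rotate h) (haar hk) (haar hk) := by
  have hmeas : Measurable (rotate h : RealGrassmannian k d → _) := by
    refine (continuous_induced_rng.mpr ?_).measurable
    have : (projMatrix ∘ rotate h : RealGrassmannian k d → _) = fun V =>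
        (h : Matrix (Fin d) (Fin d) ℝ) * V.projMatrix * star (h : Matrix (Fin d) (Fin d) ℝ) :=
      funext fun V => projMatrix_rotate h V
    rw [this]
    exact (continuous_const.mul continuous_projMatrix).mul continuous_const
  refine ⟨hmeas, ?_⟩
  have hinv : (orthogonalHaar d).map (h * ·) = orthogonalHaar d := by
    rw [orthogonalHaar]; exact map_mul_left_eq_self _ h
  have hr := (continuous_rotate (coordinate hk)).measurable
  rw [haar, Measure.map_map hmeas hr]
  conv_rhs => rw [← hinv, Measure.map_map hr (measurable_const_mul h)]
  congr 1
  funext g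
  exact rotate_rotate _ _ _

theorem exists_orthogonalIsometry_apply_eq {x y : EuclideanSpace ℝ (Fin d)} (h : ‖x‖ = ‖y‖) :
    ∃ g : Matrix.orthogonalGroup (Fin d) ℝ, orthogonalIsometry g x = y := by
  -- The reflection in the hyperplane orthogonal to `x - y` exchanges two vectors of equal norm.
  let ρ := (ℝ ∙ (x - y))ᗮ.reflection
  have hρ : ρ x = y := Submodule.reflection_sub h
  let A : Matrix (Fin d) (Fin d) ℝ := Matrix.toEuclideanLin.symm ρ.toLinearEquiv.toLinearMap
  have hA : ∀ v, Matrix.toEuclideanLin A v = ρ v := fun v => by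
    rw [LinearEquiv.apply_symm_apply]; rfl
  have hmem : A ∈ Matrix.orthogonalGroup (Fin d) ℝ := by
    rw [Matrix.mem_orthogonalGroup_iff', ← Matrix.conjTranspose_eq_transpose_of_trivial]
    apply Matrix.toEuclideanLin.injective
    refine LinearMap.ext fun v => ?_
    refine ext_inner_left ℝ fun w => ?_
    have h1 : Matrix.toEuclideanLin (A.conjTranspose * A) v =
        Matrix.toEuclideanLin A.conjTranspose (Matrix.toEuclideanLin A v) :=
      congrArg (WithLp.toLp 2) (Matrix.mulVec_mulVec v.ofLp _ _).symm
    rw [h1, Matrix.toEuclideanLin_conjTranspose_eq_adjoint,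
      LinearMap.adjoint_inner_right, hA, hA, ρ.inner_map_map]
    congr 1
    exact (congrArg (WithLp.toLp 2) (Matrix.one_mulVec v.ofLp)).symm
  exact ⟨⟨A, hmem⟩, (hA x).trans hρ⟩

/-- The law of `‖P_V x‖²` depends only on the norm of `x`. -/
theorem integral_comp_projNormSq_eq (hk : k ≤ d) {x y : EuclideanSpace ℝ (Fin d)}
    (h : ‖x‖ = ‖y‖) {φ : ℝ → ℝ} (hφ : Measurable φ) :
    ∫ V, φ (V.projNormSq x) ∂haar hk = ∫ V, φ (V.projNormSq y) ∂haar hk := by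
  obtain ⟨g, rfl⟩ := exists_orthogonalIsometry_apply_eq h
  have hm := measurePreserving_rotate hk g
  have h1 := integral_map (μ := haar hk) hm.measurable.aemeasurable
    ((hφ.comp (measurable_projNormSq (orthogonalIsometry g x))).aestronglyMeasurable)
  rw [hm.map_eq] at h1
  simp only [Function.comp_apply, projNormSq_rotate] at h1
  exact h1.symm

/-- The `w i` form an orthonormal basis of `V`, but later arguments need only their unit norms. -/
theorem exists_orthonormal_projNormSq (V : RealGrassmannian k d) :
    ∃ w : Fin k → EuclideanSpace ℝ (Fin d), (∀ i, ‖w i‖ = 1) ∧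
      ∀ x, V.projNormSq x = ∑ i, (inner ℝ (w i) x) ^ 2 := by
  let b := (stdOrthonormalBasis ℝ V.1).reindex (finCongr V.2)
  refine ⟨fun i => b i, fun i => b.orthonormal.1 i, fun x => ?_⟩
  have h := b.sum_sq_norm_inner_right (V.1.orthogonalProjectionOnto x)
  have h2 : ‖V.1.starProjection x‖ = ‖V.1.orthogonalProjectionOnto x‖ := rfl
  rw [projNormSq, h2, ← h]
  refine Finset.sum_congr rfl fun i _ => ?_
  rw [Real.norm_eq_abs, sq_abs]
  congr 1
  simp

theorem integrable_comp_projNormSq (hk : k ≤ d) (x : EuclideanSpace ℝ (Fin d))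
    {φ : ℝ → ℝ} (hφ : Continuous φ) :
    Integrable (fun V => φ (V.projNormSq x)) (haar hk) := by
  obtain ⟨C, hC⟩ := (isCompact_Icc (a := 0) (b := ‖x‖ ^ 2)).exists_bound_of_continuousOn
    hφ.continuousOn
  exact Integrable.of_bound
    (hφ.measurable.comp (measurable_projNormSq x)).aestronglyMeasurable C
    (ae_of_all _ fun V => hC _ ⟨projNormSq_nonneg V x, projNormSq_le V x⟩)

theorem integrable_projNormSq (hk : k ≤ d) (x : EuclideanSpace ℝ (Fin d)) :
    Integrable (fun V => V.projNormSq x) (haar hk) :=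
  integrable_comp_projNormSq hk x continuous_id

/-- All standard basis vectors share the same mean, and these means add up to the trace `k` of the
projector. -/
theorem integral_projNormSq (hk : k ≤ d) (hd : d ≠ 0) {x : EuclideanSpace ℝ (Fin d)}
    (hx : ‖x‖ = 1) :
    ∫ V, V.projNormSq x ∂haar hk = k / d := by
  let e := EuclideanSpace.basisFun (Fin d) ℝ
  have hsum : ∀ V : RealGrassmannian k d, ∑ j, V.projNormSq (e j) = k := by
    intro V
    obtain ⟨w, hw, hV⟩ := exists_orthonormal_projNormSq V
    simp_rw [hV]
    rw [Finset.sum_comm]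
    have h1 : ∀ i, ∑ j, (inner ℝ (w i) (e j)) ^ 2 = 1 := fun i => by
      have := e.sum_sq_norm_inner_left (w i)
      simpa [hw i, e] using this
    simp [h1]
  have h2 : ∑ j, ∫ V, V.projNormSq (e j) ∂haar hk = k := by
    rw [← integral_finsetSum _ fun j _ =>
      integrable_projNormSq hk (e j)]
    simp [hsum]
  have h3 : ∀ j, ∫ V, V.projNormSq (e j) ∂haar hk =
      ∫ V, V.projNormSq x ∂haar hk := fun j =>
    integral_comp_projNormSq_eq hk ((e.orthonormal.1 j).trans hx.symm) measurable_id
  have hd' : (d : ℝ) ≠ 0 := Nat.cast_ne_zero.mpr hd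
  simp only [h3, Finset.sum_const, Finset.card_univ, Fintype.card_fin, nsmul_eq_mul] at h2
  field_simp
  linarith

end RealGrassmannian

/-! ### Uniform exponential moments by averaging over signs -/

theorem integrable_exp_sq_div_four_gaussianReal :
    Integrable (fun z : ℝ => Real.exp (z ^ 2 / 4)) (gaussianReal 0 1) := by
  rw [gaussianReal_of_var_ne_zero 0 one_ne_zero]
  rw [integrable_withDensity_iff_integrable_smul' (measurable_gaussianPDF 0 1)
    (ae_of_all _ fun _ => gaussianPDF_lt_top)]
  simp only [toReal_gaussianPDF]
  have h := (integrable_exp_neg_mul_sq (b := 1 / 4) (by norm_num)).const_mul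
    (√(2 * Real.pi))⁻¹
  refine h.congr (ae_of_all _ fun z => ?_)
  simp only [gaussianPDFReal, smul_eq_mul, mul_assoc, ← Real.exp_add, NNReal.coe_one]
  ring_nf

/-- The sign vectors in `{-1, 1}^ι`. -/
noncomputable def signVectors (ι : Type*) [Fintype ι] [DecidableEq ι] : Finset (ι → ℝ) :=
  Fintype.piFinset fun _ => {-1, 1}

section signVectors

variable {ι : Type*} [Fintype ι] [DecidableEq ι]

theorem card_signVectors : (signVectors ι).card = 2 ^ Fintype.card ι := by
  have h : ({-1, 1} : Finset ℝ).card = 2 := Finset.card_pair (by norm_num)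
  simp [signVectors, Fintype.card_piFinset, h]

theorem sq_eq_one_of_mem_signVectors {ε : ι → ℝ} (hε : ε ∈ signVectors ι) (i : ι) :
    ε i ^ 2 = 1 := by
  have := Fintype.mem_piFinset.mp hε i
  rcases Finset.mem_insert.mp this with h | h
  · rw [h]; norm_num
  · rw [Finset.mem_singleton.mp h]; norm_num

theorem sum_signVectors_exp_le (a : ι → ℝ) :
    ∑ ε ∈ signVectors ι, Real.exp (∑ i, a i * ε i) ≤
      2 ^ Fintype.card ι * Real.exp ((∑ i, a i ^ 2) / 2) := by
  have h : ∀ b : ℝ, ∑ e ∈ ({-1, 1} : Finset ℝ), Real.exp (b * e) = 2 * Real.cosh b := fun b => by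
    rw [Finset.sum_pair (by norm_num), Real.cosh_eq]
    simp only [mul_neg, mul_one]
    ring
  simp_rw [Real.exp_sum]
  rw [signVectors, ← Finset.prod_univ_sum (fun _ => ({-1, 1} : Finset ℝ))
    (fun i e => Real.exp (a i * e)), Finset.sum_div, Real.exp_sum, ← Finset.card_univ,
    ← Finset.prod_const, ← Finset.prod_mul_distrib]
  refine Finset.prod_le_prod (fun i _ => Finset.sum_nonneg fun _ _ => (Real.exp_pos _).le)
    fun i _ => ?_
  rw [h]
  gcongr
  exact Real.cosh_le_exp_half_sq _

/-- The square is linearized by `exp (y²/4) = E exp (y z / √2)` with `z` standard Gaussian; for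
fixed `z` the sub-Gaussian bound on Rademacher sums applies. -/
theorem sum_signVectors_exp_sq_le {a : ι → ℝ} (ha : ∑ i, a i ^ 2 = 1) :
    ∑ ε ∈ signVectors ι, Real.exp ((∑ i, a i * ε i) ^ 2 / 4) ≤
      2 ^ Fintype.card ι * ∫ z, Real.exp (z ^ 2 / 4) ∂gaussianReal 0 1 := by
  have h2 : √2 ^ 2 = (2 : ℝ) := Real.sq_sqrt (by norm_num)
  have h : ∀ y : ℝ, Real.exp (y ^ 2 / 4) = ∫ z, Real.exp (y / √2 * z) ∂gaussianReal 0 1 := by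
    intro y
    have := congrFun (mgf_fun_id_gaussianReal (μ := 0) (v := 1)) (y / √2)
    simp only [mgf] at this
    rw [this, div_pow, h2, NNReal.coe_one]
    ring_nf
  calc ∑ ε ∈ signVectors ι, Real.exp ((∑ i, a i * ε i) ^ 2 / 4)
      = ∫ z, ∑ ε ∈ signVectors ι, Real.exp ((∑ i, a i * ε i) / √2 * z) ∂gaussianReal 0 1 := by
        rw [integral_finsetSum _ fun ε _ => integrable_exp_mul_gaussianReal _]
        exact Finset.sum_congr rfl fun ε _ => h _
    _ ≤ ∫ z, 2 ^ Fintype.card ι * Real.exp (z ^ 2 / 4) ∂gaussianReal 0 1 := by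
        refine integral_mono (integrable_finsetSum _ fun ε _ => integrable_exp_mul_gaussianReal _)
          (integrable_exp_sq_div_four_gaussianReal.const_mul _) fun z => ?_
        have h3 := sum_signVectors_exp_le fun i => z / √2 * a i
        simp only [mul_pow, ← Finset.mul_sum, ha, div_pow, h2] at h3
        refine (Finset.sum_congr rfl fun ε _ => ?_).trans_le (h3.trans_eq ?_)
        · simp only [mul_assoc, ← Finset.mul_sum]
          ring_nf
        · ring_nf
    _ = _ := integral_const_mul _ _

end signVectors

namespace RealGrassmannian

variable {k d : ℕ}

theorem projNormSq_smul (V : RealGrassmannian k d) (r : ℝ) (x : EuclideanSpace ℝ (Fin d)) :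
    V.projNormSq (r • x) = r ^ 2 * V.projNormSq x := by
  rw [projNormSq, map_smul, norm_smul, mul_pow, Real.norm_eq_abs, sq_abs, projNormSq]

/-- Jensen's inequality: `‖P_V ε‖² / k` is the average of `k` squared Rademacher sums with unit
coefficient vectors. -/
theorem sum_signVectors_exp_projNormSq_le (hk : k ≠ 0) (V : RealGrassmannian k d) :
    ∑ ε ∈ signVectors (Fin d), Real.exp (V.projNormSq (WithLp.toLp 2 ε) / k / 4) ≤
      2 ^ d * ∫ z, Real.exp (z ^ 2 / 4) ∂gaussianReal 0 1 := by
  obtain ⟨w, hw, hV⟩ := exists_orthonormal_projNormSq V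
  have hk' : (k : ℝ) ≠ 0 := Nat.cast_ne_zero.mpr hk
  have hconv : ∀ ε : Fin d → ℝ, Real.exp (V.projNormSq (WithLp.toLp 2 ε) / k / 4) ≤
      ∑ i : Fin k, (k : ℝ)⁻¹ * Real.exp ((∑ j, w i j * ε j) ^ 2 / 4) := by
    intro ε
    have h := convexOn_exp.map_sum_le (t := Finset.univ) (w := fun _ : Fin k => (k : ℝ)⁻¹)
      (p := fun i => (∑ j, w i j * ε j) ^ 2 / 4) (fun _ _ => by positivity)
      (by simp [hk']) (fun _ _ => Set.mem_univ _)
    simp only [smul_eq_mul] at h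
    refine le_trans (le_of_eq ?_) h
    rw [hV, ← Finset.mul_sum, ← Finset.sum_div]
    simp only [PiLp.inner_apply, RCLike.inner_apply, conj_trivial, mul_comm]
    ring_nf
  refine (Finset.sum_le_sum fun ε _ => hconv ε).trans ?_
  rw [Finset.sum_comm]
  have hi : ∀ i : Fin k, ∑ ε ∈ signVectors (Fin d),
      (k : ℝ)⁻¹ * Real.exp ((∑ j, w i j * ε j) ^ 2 / 4) ≤
      (k : ℝ)⁻¹ * (2 ^ d * ∫ z, Real.exp (z ^ 2 / 4) ∂gaussianReal 0 1) := by
    intro i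
    rw [← Finset.mul_sum]
    gcongr
    have := sum_signVectors_exp_sq_le (a := fun j => w i j)
      (by rw [← EuclideanSpace.real_norm_sq_eq, hw, one_pow])
    simpa using this
  refine (Finset.sum_le_sum fun i _ => hi i).trans (le_of_eq ?_)
  simp [hk']

/-- The exponential moments of `(d / k) ‖P_V x‖²` are bounded independently of `k` and `d`. -/
theorem integral_exp_projNormSq_le (hk0 : k ≠ 0) (hk : k ≤ d) {x : EuclideanSpace ℝ (Fin d)}
    (hx : ‖x‖ = 1) :
    ∫ V, Real.exp (d / k * V.projNormSq x / 4) ∂haar hk ≤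
      ∫ z, Real.exp (z ^ 2 / 4) ∂gaussianReal 0 1 := by
  have hd : (d : ℝ) ≠ 0 := Nat.cast_ne_zero.mpr (by omega)
  have hφ : Continuous fun u : ℝ => Real.exp (d / k * u / 4) := by fun_prop
  have hφ' : Continuous fun u : ℝ => Real.exp (u / k / 4) := by fun_prop
  -- The unit vector `ε/√d` replaces `x`; its normalization cancels the factor `d`.
  have heq : ∀ ε ∈ signVectors (Fin d), ∫ V, Real.exp (d / k * V.projNormSq x / 4) ∂haar hk =
      ∫ V, Real.exp (V.projNormSq (WithLp.toLp 2 ε) / k / 4) ∂haar hk := by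
    intro ε hε
    have hnorm : ‖(√(d : ℝ))⁻¹ • (WithLp.toLp 2 ε : EuclideanSpace ℝ (Fin d))‖ = 1 := by
      have h1 : ‖(WithLp.toLp 2 ε : EuclideanSpace ℝ (Fin d))‖ = √(d : ℝ) := by
        rw [EuclideanSpace.norm_eq]
        simp [sq_eq_one_of_mem_signVectors hε]
      rw [norm_smul, h1, Real.norm_eq_abs, abs_of_nonneg (by positivity)]
      exact inv_mul_cancel₀ (by simpa using hd)
    rw [integral_comp_projNormSq_eq hk (hx.trans hnorm.symm) hφ.measurable]
    congr 1
    funext V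
    rw [projNormSq_smul, inv_pow, Real.sq_sqrt (by positivity)]
    congr 2
    field_simp
  have hsum : 2 ^ d * ∫ V, Real.exp (d / k * V.projNormSq x / 4) ∂haar hk ≤
      2 ^ d * ∫ z, Real.exp (z ^ 2 / 4) ∂gaussianReal 0 1 := by
    calc 2 ^ d * ∫ V, Real.exp (d / k * V.projNormSq x / 4) ∂haar hk
        = ∑ ε ∈ signVectors (Fin d),
            ∫ V, Real.exp (V.projNormSq (WithLp.toLp 2 ε) / k / 4) ∂haar hk := by
          rw [← Finset.sum_congr rfl heq, Finset.sum_const, card_signVectors, Fintype.card_fin,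
            nsmul_eq_mul]
          push_cast
          rfl
      _ = ∫ V, ∑ ε ∈ signVectors (Fin d),
            Real.exp (V.projNormSq (WithLp.toLp 2 ε) / k / 4) ∂haar hk :=
          (integral_finsetSum _ fun ε _ => integrable_comp_projNormSq hk _ hφ').symm
      _ ≤ ∫ V, 2 ^ d * ∫ z, Real.exp (z ^ 2 / 4) ∂gaussianReal 0 1 ∂haar hk := by
          refine integral_mono (integrable_finsetSum _ fun ε _ =>
            integrable_comp_projNormSq hk _ hφ') (integrable_const _) fun V => ?_
          exact sum_signVectors_exp_projNormSq_le hk0 V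
      _ = _ := by simp
  exact le_of_mul_le_mul_left hsum (by positivity)

end RealGrassmannian

/-! ### Sub-exponential variables and Bernstein's bound -/

theorem Real.exp_le_one_add_add_sq_mul_exp_abs (u : ℝ) :
    Real.exp u ≤ 1 + u + u ^ 2 * Real.exp |u| := by
  have h := Complex.norm_exp_sub_sum_le_norm_mul_exp (u : ℂ) 2
  simp only [Finset.sum_range_succ, Finset.sum_range_zero, pow_zero, pow_one, Nat.factorial,
    Nat.cast_one, div_one, zero_add, Nat.succ_eq_add_one, mul_one] at h
  rw [← Complex.ofReal_exp, ← Complex.ofReal_one, ← Complex.ofReal_add, ← Complex.ofReal_sub,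
    Complex.norm_real, Complex.norm_real, Real.norm_eq_abs, Real.norm_eq_abs, sq_abs] at h
  linarith [le_abs_self (Real.exp u - (1 + u))]

theorem Real.exp_mul_sub_one_le {l y : ℝ} (hl : |l| ≤ 1 / 8) (hy : 0 ≤ y) :
    Real.exp (l * (y - 1)) ≤
      1 + l * (y - 1) + 128 * Real.exp (1 / 4) * l ^ 2 * Real.exp (y / 4) := by
  refine (Real.exp_le_one_add_add_sq_mul_exp_abs _).trans (add_le_add_right ?_ _)
  -- This `v` dominates `|l * (y - 1)|` and satisfies `2v = 1/4 + y/4`: one factor `exp v` absorbs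
  -- the square, the other bounds the remainder.
  set v := (y + 1) / 8 with hv
  have hX : |y - 1| ≤ 8 * v := by rw [abs_le]; constructor <;> linarith
  have hv0 : 0 ≤ v := by positivity
  have h1 : v ^ 2 ≤ 2 * Real.exp v := by
    linarith [Real.quadratic_le_exp_of_nonneg hv0]
  have h2 : |l * (y - 1)| ≤ v := by
    rw [abs_mul]
    nlinarith [abs_nonneg l, abs_nonneg (y - 1)]
  have h3 : (y - 1) ^ 2 ≤ 64 * v ^ 2 := by
    rw [← sq_abs]
    nlinarith [abs_nonneg (y - 1)]
  calc (l * (y - 1)) ^ 2 * Real.exp |l * (y - 1)|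
      ≤ (l ^ 2 * (64 * (2 * Real.exp v))) * Real.exp v := by
        rw [mul_pow]
        gcongr
        linarith
    _ = 128 * l ^ 2 * (Real.exp v * Real.exp v) := by ring
    _ = 128 * l ^ 2 * (Real.exp (1 / 4) * Real.exp (y / 4)) := by
        rw [← Real.exp_add, ← Real.exp_add, hv]; ring_nf
    _ = _ := by ring

/-- A nonnegative variable of mean one with a bounded exponential moment is sub-exponential. -/
theorem mgf_sub_one_le_of_exp_moment {Ω : Type*} [MeasurableSpace Ω] {μ : Measure Ω}
    [IsProbabilityMeasure μ] {Y : Ω → ℝ} {K l : ℝ} (hY : ∀ ω, 0 ≤ Y ω) (hint : Integrable Y μ)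
    (hmean : ∫ ω, Y ω ∂μ = 1) (hexp : Integrable (fun ω => Real.exp (Y ω / 4)) μ)
    (hK : ∫ ω, Real.exp (Y ω / 4) ∂μ ≤ K) (hl : |l| ≤ 1 / 8)
    (hintl : Integrable (fun ω => Real.exp (l * (Y ω - 1))) μ) :
    mgf (fun ω => Y ω - 1) μ l ≤ Real.exp (128 * Real.exp (1 / 4) * K * l ^ 2) := by
  have hi1 : Integrable (fun ω => l * (Y ω - 1)) μ := (hint.sub (integrable_const 1)).const_mul l
  have hi2 : Integrable (fun ω => 1 + l * (Y ω - 1)) μ := (integrable_const 1).add hi1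
  have hi3 := hexp.const_mul (128 * Real.exp (1 / 4) * l ^ 2)
  calc mgf (fun ω => Y ω - 1) μ l
      ≤ ∫ ω, (1 + l * (Y ω - 1) + 128 * Real.exp (1 / 4) * l ^ 2 * Real.exp (Y ω / 4)) ∂μ :=
        integral_mono hintl (hi2.add hi3) fun ω => Real.exp_mul_sub_one_le hl (hY ω)
    _ = 1 + 128 * Real.exp (1 / 4) * l ^ 2 * ∫ ω, Real.exp (Y ω / 4) ∂μ := by
        rw [integral_add hi2 hi3, integral_add (integrable_const 1) hi1, integral_const_mul,
          integral_const_mul, integral_sub hint (integrable_const 1), hmean]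
        simp
    _ ≤ 1 + 128 * Real.exp (1 / 4) * l ^ 2 * K := by gcongr
    _ ≤ _ := by
        rw [add_comm]
        refine (Real.add_one_le_exp _).trans_eq ?_
        ring_nf

/-- Two-sided Chernoff bound for sums of independent sub-exponential variables. -/
theorem measureReal_le_abs_sum_le {Ω ι : Type*} [MeasurableSpace Ω] {μ : Measure Ω}
    [IsProbabilityMeasure μ] [Fintype ι] {X : ι → Ω → ℝ} (hX : ∀ j, AEMeasurable (X j) μ)
    (hind : iIndepFun X μ) {B l T : ℝ} (hl : 0 ≤ l)
    (hint : ∀ s : ℝ, Integrable (fun ω => Real.exp (s * (∑ j, X j) ω)) μ)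
    (hmgf : ∀ s, |s| = l → ∀ j, mgf (X j) μ s ≤ Real.exp (B * s ^ 2)) :
    μ.real {ω | T ≤ |∑ j, X j ω|} ≤
      2 * Real.exp (-l * T + Fintype.card ι * B * l ^ 2) := by
  have hsum : ∀ s, |s| = l → mgf (∑ j, X j) μ s ≤ Real.exp (Fintype.card ι * B * l ^ 2) := by
    intro s hs
    rw [hind.mgf_sum₀ hX, ← hs, sq_abs]
    refine (Finset.prod_le_prod (fun _ _ => mgf_nonneg) fun j _ => hmgf s hs j).trans_eq ?_
    rw [Finset.prod_const, ← Real.exp_nat_mul, Finset.card_univ, mul_assoc]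
  have h1 := measure_ge_le_exp_mul_mgf (μ := μ) (X := ∑ j, X j) T hl (hint l)
  have h2 := measure_le_le_exp_mul_mgf (μ := μ) (X := ∑ j, X j) (t := -l) (-T) (by linarith)
    (hint (-l))
  have h3 : {ω | T ≤ |∑ j, X j ω|} ⊆
      {ω | T ≤ (∑ j, X j) ω} ∪ {ω | (∑ j, X j) ω ≤ -T} := by
    intro ω hω
    simp only [Set.mem_union, Set.mem_ofPred_eq, Finset.sum_apply] at hω ⊢
    rcases le_abs.mp hω with h | h
    · exact Or.inl h
    · exact Or.inr (by linarith)
  refine (measureReal_mono h3).trans ((measureReal_union_le _ _).trans ?_)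
  have h4 := mul_le_mul_of_nonneg_left (hsum l (abs_of_nonneg hl)) (Real.exp_pos (-l * T)).le
  have h5 := mul_le_mul_of_nonneg_left (hsum (-l) (by rw [abs_neg, abs_of_nonneg hl]))
    (Real.exp_pos (-(-l) * -T)).le
  rw [Real.exp_add]
  have h6 : -(-l) * -T = -l * T := by ring
  rw [h6] at h2 h5
  linarith

/-- Bernstein's optimization of the Chernoff exponent, with threshold `max (√n a) a² / 32`. -/
theorem exists_chernoff_parameter {n B c a : ℝ} (hn : 0 ≤ n) (hc : 0 ≤ c) (hcB : c * B ≤ 1 / 64)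
    (hB : 0 ≤ B) (ha : 0 ≤ a) :
    ∃ l, 0 ≤ l ∧ l ≤ c ∧
      -l * (max (√n * a) (a ^ 2) / 32) + n * B * l ^ 2 ≤ -(c / 64) * a ^ 2 := by
  have hs := Real.sqrt_nonneg n
  have hsq := Real.sq_sqrt hn
  -- In the Gaussian regime `a ≤ √n` the parameter is `c a / √n`; beyond it, it is capped at `c`. In
  -- both cases `c B ≤ 1/64` makes the quadratic term at most half of the linear gain `c a² / 32`.
  rcases le_total a (√n) with h | h
  · rcases eq_or_ne (√n) 0 with h0 | h0
    · exact ⟨0, le_rfl, hc, by simp [le_antisymm (h0 ▸ h) ha]⟩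
    refine ⟨c * (a / √n), by positivity,
      mul_le_of_le_one_right hc (div_le_one_of_le₀ h hs), ?_⟩
    rw [max_eq_left (by nlinarith)]
    have h1 : -(c * (a / √n)) * (√n * a / 32) + n * B * (c * (a / √n)) ^ 2 =
        -(c / 32) * a ^ 2 + (c * B) * (c * a ^ 2) := by
      nth_rw 3 [← hsq]
      field_simp
    rw [h1]
    nlinarith [mul_le_mul_of_nonneg_right hcB (by positivity : 0 ≤ c * a ^ 2)]
  · refine ⟨c, hc, le_rfl, ?_⟩
    rw [max_eq_right (by nlinarith)]
    have h1 : n ≤ a ^ 2 := by nlinarith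
    have h2 : n * B * c ^ 2 ≤ a ^ 2 * (c * (c * B)) := by
      have := mul_le_mul_of_nonneg_right h1 (by positivity : 0 ≤ c * (c * B))
      linarith
    nlinarith [mul_le_mul_of_nonneg_left hcB (by positivity : 0 ≤ a ^ 2 * c)]

/-- The lower bound is trivial for `√n ≤ a`; otherwise `(√n - a)² ≤ n - √n a`. The upper bound uses
`n + √n a + a² ≤ (√n + a)²`. -/
theorem sqrt_bounds_of_abs_sq_sub_le {n a z : ℝ} (hn : 0 ≤ n) (ha : 0 ≤ a) (hz : 0 ≤ z)
    (h : |z ^ 2 - n| ≤ max (√n * a) (a ^ 2)) : √n - a ≤ z ∧ z ≤ √n + a := by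
  have hs := Real.sqrt_nonneg n
  have hsq := Real.sq_sqrt hn
  obtain ⟨h1, h2⟩ := abs_le.mp h
  have hsa : 0 ≤ √n * a := by positivity
  constructor
  · rcases le_total (√n) a with h3 | h3
    · linarith
    · rw [max_eq_left (by nlinarith)] at h1
      refine le_of_sq_le_sq ?_ hz
      nlinarith
  · refine le_of_sq_le_sq ?_ (by positivity)
    have : max (√n * a) (a ^ 2) ≤ √n * a + a ^ 2 := max_le (by nlinarith) (by linarith)
    nlinarith

/-! ### The stacked matrix: fixed vectors and the whole sphere -/

namespace RealGrassmannian

variable {k d : ℕ}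

theorem norm_sq_stackedProj_apply {n : ℕ} (V : Fin n → RealGrassmannian k d)
    (x : EuclideanSpace ℝ (Fin d)) :
    ‖Matrix.toEuclideanLin (stackedProj V) x‖ ^ 2 = ∑ j, (d : ℝ) / k * (V j).projNormSq x := by
  rw [EuclideanSpace.real_norm_sq_eq, Fintype.sum_prod_type]
  refine Finset.sum_congr rfl fun j _ => ?_
  rw [projNormSq, starProjection_apply_eq, EuclideanSpace.real_norm_sq_eq, Finset.mul_sum]
  refine Finset.sum_congr rfl fun i _ => ?_
  have h : Matrix.toEuclideanLin (stackedProj V) x (j, i) =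
      √((d : ℝ) / k) * Matrix.toEuclideanLin (V j).projMatrix x i := by
    change ∑ b, √((d : ℝ) / k) * (V j).projMatrix i b * x b =
      √((d : ℝ) / k) * ∑ b, (V j).projMatrix i b * x b
    simp_rw [Finset.mul_sum, mul_assoc]
  rw [h, mul_pow, Real.sq_sqrt (by positivity)]

/-- If `‖P x‖²` is close to `n` on a `1/2`-net, the singular values are close to `√n`. -/
theorem stackedProj_sMin_sMax_bounds {n : ℕ} [NeZero d] (V : Fin n → RealGrassmannian k d)
    {s : Finset (EuclideanSpace ℝ (Fin d))} (hs1 : ∀ y ∈ s, ‖y‖ = 1)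
    (hs : ∀ x : EuclideanSpace ℝ (Fin d), ‖x‖ = 1 → ∃ y ∈ s, ‖x - y‖ ≤ 1 / 2) {a : ℝ} (ha : 0 ≤ a)
    (hV : ∀ y ∈ s, |∑ j, ((d : ℝ) / k * (V j).projNormSq y - 1)| ≤
      max (√(n : ℝ) * a) (a ^ 2) / 32) :
    √(n : ℝ) - a ≤ (stackedProj V).sMin ∧ (stackedProj V).sMin ≤ (stackedProj V).sMax ∧
      (stackedProj V).sMax ≤ √(n : ℝ) + a := by
  refine Matrix.sMin_sMax_bounds _ fun x hx =>
    sqrt_bounds_of_abs_sq_sub_le (Nat.cast_nonneg n) ha (norm_nonneg _) ?_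
  let A := Matrix.toEuclideanLin (stackedProj V)
  -- The form of `PᵀP - n`; the `1/32` in `hV` pays for the loss in the net argument.
  let B : LinearMap.BilinForm ℝ (EuclideanSpace ℝ (Fin d)) :=
    (innerₗ (EuclideanSpace ℝ (Fin n × Fin d))).compl₁₂ A A -
      (n : ℝ) • innerₗ (EuclideanSpace ℝ (Fin d))
  have hBapp : ∀ u v, B u v = inner ℝ (A u) (A v) - n * inner ℝ u v := fun u v => rfl
  have hB : B.IsSymm := ⟨fun u v => by
    simp [hBapp, real_inner_comm]⟩
  have hBdiag : ∀ y, ‖y‖ = 1 → B y y = ‖A y‖ ^ 2 - n := fun y hy => by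
    rw [hBapp, real_inner_self_eq_norm_sq, real_inner_self_eq_norm_sq, hy]; ring
  have := abs_le_of_forall_net B hB hs1 hs (m := max (√(n : ℝ) * a) (a ^ 2) / 32)
    (fun y hy => by
      rw [hBdiag y (hs1 y hy), norm_sq_stackedProj_apply]
      simpa [Finset.sum_sub_distrib] using hV y hy) hx
  rw [hBdiag x hx] at this
  linarith

theorem mgf_projNormSq_le (hk0 : k ≠ 0) (hk : k ≤ d) {x : EuclideanSpace ℝ (Fin d)}
    (hx : ‖x‖ = 1) {l : ℝ} (hl : |l| ≤ 1 / 8) :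
    mgf (fun V => (d : ℝ) / k * V.projNormSq x - 1) (haar hk) l ≤
      Real.exp (128 * Real.exp (1 / 4) * (∫ z, Real.exp (z ^ 2 / 4) ∂gaussianReal 0 1) * l ^ 2) := by
  have hd : (d : ℝ) ≠ 0 := Nat.cast_ne_zero.mpr (by omega)
  have hk' : (k : ℝ) ≠ 0 := Nat.cast_ne_zero.mpr hk0
  refine mgf_sub_one_le_of_exp_moment
    (fun V => mul_nonneg (by positivity) (V.projNormSq_nonneg x))
    ((integrable_projNormSq hk x).const_mul _) ?_ ?_
    (integral_exp_projNormSq_le hk0 hk hx) hl ?_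
  · rw [integral_const_mul, integral_projNormSq hk (by omega) hx]
    field_simp
  · exact integrable_comp_projNormSq hk x
      (φ := fun u => Real.exp (d / k * u / 4)) (by fun_prop)
  · exact integrable_comp_projNormSq hk x
      (φ := fun u => Real.exp (l * (d / k * u - 1))) (by fun_prop)

/-- Bernstein-type tail bound for `‖P x‖²` at a fixed unit vector `x`. -/
theorem measureReal_sum_projNormSq_le {n : ℕ} (hk0 : k ≠ 0) (hk : k ≤ d) {Ω : Type*}
    [MeasurableSpace Ω] {μ : Measure Ω} [IsProbabilityMeasure μ] {V : Fin n → Ω → RealGrassmannian k d}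
    (hV : ∀ j, HasLaw (V j) (haar hk) μ) (hind : iIndepFun V μ) {x : EuclideanSpace ℝ (Fin d)}
    (hx : ‖x‖ = 1) {B c a : ℝ}
    (hB : B = 128 * Real.exp (1 / 4) * ∫ z, Real.exp (z ^ 2 / 4) ∂gaussianReal 0 1)
    (hc : 0 ≤ c) (hc8 : c ≤ 1 / 8) (hcB : c * B ≤ 1 / 64) (ha : 0 ≤ a) :
    μ.real {ω | max (√(n : ℝ) * a) (a ^ 2) / 32 ≤
        |∑ j, ((d : ℝ) / k * (V j ω).projNormSq x - 1)|} ≤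
      2 * Real.exp (-(c / 64) * a ^ 2) := by
  have hB0 : 0 ≤ B := by
    rw [hB]
    exact mul_nonneg (by positivity) (integral_nonneg fun _ => (Real.exp_pos _).le)
  obtain ⟨l, hl0, hlc, hl⟩ := exists_chernoff_parameter (Nat.cast_nonneg n) hc hcB hB0 ha
  let f : RealGrassmannian k d → ℝ := fun W => (d : ℝ) / k * W.projNormSq x - 1
  have hf : Measurable f := ((measurable_projNormSq x).const_mul _).sub_const _
  have hfm : ∀ j, AEMeasurable (fun ω => f (V j ω)) μ := fun j =>
    hf.comp_aemeasurable (hV j).aemeasurable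
  have hbound : ∀ W, |f W| ≤ (d : ℝ) / k + 1 := fun W => by
    have h1 := W.projNormSq_le x
    have h2 := W.projNormSq_nonneg x
    rw [hx, one_pow] at h1
    have h3 : 0 ≤ (d : ℝ) / k := by positivity
    rw [abs_le]
    constructor <;> simp only [f] <;> nlinarith
  refine (measureReal_le_abs_sum_le (X := fun j ω => f (V j ω)) (B := B) hfm
    (hind.comp (fun _ => f) fun _ => hf) hl0 (fun s => ?_) fun s hs j => ?_).trans ?_
  · have hSm : AEMeasurable (∑ j, fun ω => f (V j ω)) μ :=
      Finset.aemeasurable_sum _ fun j _ => hfm j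
    refine Integrable.of_bound (Real.measurable_exp.comp_aemeasurable
      (hSm.const_mul s)).aestronglyMeasurable (Real.exp (|s| * (n * ((d : ℝ) / k + 1))))
      (ae_of_all _ fun ω => ?_)
    rw [Real.norm_eq_abs, Real.abs_exp, Real.exp_le_exp]
    refine (le_abs_self _).trans ?_
    rw [abs_mul]
    gcongr
    rw [Finset.sum_apply]
    refine (Finset.abs_sum_le_sum_abs _ _).trans
      ((Finset.sum_le_sum fun j _ => hbound (V j ω)).trans_eq ?_)
    rw [Finset.sum_const, Finset.card_univ, Fintype.card_fin, nsmul_eq_mul]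
  · have h1 : mgf (fun ω => f (V j ω)) μ s = mgf f (haar hk) s := by
      rw [← (hV j).map_eq, mgf_map (hV j).aemeasurable]
      · rfl
      · exact (Real.measurable_exp.comp (hf.const_mul s)).aestronglyMeasurable
    rw [h1, hB]
    exact mgf_projNormSq_le hk0 hk hx (by rw [hs]; linarith)
  · rw [Fintype.card_fin]
    gcongr

end RealGrassmannian

/-! ### Union bound and choice of constants -/

theorem proposition5p5 :
    ∃ c C : ℝ, 0 < c ∧ 0 < C ∧
      ∀ (n k d : ℕ) (_ : 1 ≤ k) (hkd : k ≤ d)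
        {Ω : Type*} [MeasurableSpace Ω] (μ : Measure Ω) [IsProbabilityMeasure μ]
        (V : Fin n → Ω → RealGrassmannian k d)
        (_ : ∀ j, HasLaw (V j) (RealGrassmannian.haar hkd) μ) (_ : iIndepFun V μ)
        (t : ℝ) (_ : 0 ≤ t),
        1 - 2 * Real.exp (-c * t ^ 2) ≤
          μ.real {ω |
            √(n : ℝ) - C * √(d : ℝ) - t ≤
                (RealGrassmannian.stackedProj fun j => V j ω).sMin ∧
              (RealGrassmannian.stackedProj fun j => V j ω).sMin ≤
                (RealGrassmannian.stackedProj fun j => V j ω).sMax ∧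
              (RealGrassmannian.stackedProj fun j => V j ω).sMax ≤
                √(n : ℝ) + C * √(d : ℝ) + t} := by
  set B : ℝ := 128 * Real.exp (1 / 4) * ∫ z, Real.exp (z ^ 2 / 4) ∂gaussianReal 0 1 with hB
  have hB0 : 0 ≤ B := mul_nonneg (by positivity) (integral_nonneg fun _ => (Real.exp_pos _).le)
  set c : ℝ := 1 / (64 * (B + 1)) with hc
  have hc0 : 0 < c := by positivity
  have hc8 : c ≤ 1 / 8 := by
    rw [hc]; apply one_div_le_one_div_of_le <;> linarith
  have hcB : c * B ≤ 1 / 64 := by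
    rw [hc, one_div_mul_eq_div, div_le_div_iff₀ (by positivity) (by norm_num)]
    linarith
  -- `C` is chosen with `(c/64) C² = 2`, so that `exp (-(c/64) C² d) = exp (-2d)` cancels the bound
  -- `5 ^ d ≤ exp (2d)` on the net.
  refine ⟨c / 64, √(2 / (c / 64)), by positivity, by positivity, ?_⟩
  intro n k d hk hkd Ω _ μ _ V hV hind t ht
  have : NeZero d := ⟨by omega⟩
  set C := √(2 / (c / 64)) with hC
  have hC2 : c / 64 * C ^ 2 = 2 := by
    rw [hC, Real.sq_sqrt (by positivity)]; field_simp
  set a := C * √(d : ℝ) + t with ha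
  have ha0 : 0 ≤ a := by positivity
  obtain ⟨s, hcard, hs1, hs⟩ := exists_half_net_sphere (EuclideanSpace ℝ (Fin d))
  rw [finrank_euclideanSpace, Fintype.card_fin] at hcard
  let bad : EuclideanSpace ℝ (Fin d) → Set Ω := fun y =>
    {ω | max (√(n : ℝ) * a) (a ^ 2) / 32 ≤ |∑ j, ((d : ℝ) / k * (V j ω).projNormSq y - 1)|}
  set good : Set Ω := {ω | _} with hgood
  change _ ≤ μ.real good
  -- A covering and subadditivity suffice, so measurability of `good` is never needed.
  have hcover : Set.univ ⊆ good ∪ ⋃ y ∈ s, bad y := by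
    intro ω _
    by_cases hω : ∃ y ∈ s, ω ∈ bad y
    · obtain ⟨y, hy, h⟩ := hω
      exact Or.inr (Set.mem_biUnion hy h)
    · push Not at hω
      left
      have h := RealGrassmannian.stackedProj_sMin_sMax_bounds (fun j => V j ω) hs1 hs ha0
        fun y hy => (not_le.mp (hω y hy)).le
      rw [hgood, Set.mem_ofPred_eq, sub_sub, add_assoc]
      exact h
  have hbad : μ.real (⋃ y ∈ s, bad y) ≤ 2 * Real.exp (-(c / 64) * t ^ 2) := by
    have h5 : (5 : ℝ) ^ d ≤ Real.exp (2 * d) := by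
      have h6 : (5 : ℝ) ≤ Real.exp 2 := by
        linarith [Real.quadratic_le_exp_of_nonneg (x := 2) (by norm_num)]
      calc (5 : ℝ) ^ d ≤ Real.exp 2 ^ d := by gcongr
        _ = _ := by rw [← Real.exp_nat_mul, mul_comm]
    have hsq : C ^ 2 * d + t ^ 2 ≤ a ^ 2 := by
      have h7 : (C * √(d : ℝ)) ^ 2 = C ^ 2 * d := by
        rw [mul_pow, Real.sq_sqrt (Nat.cast_nonneg d)]
      have h8 : 0 ≤ C * √(d : ℝ) * t := by positivity
      rw [ha, add_sq, h7]
      linarith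
    calc μ.real (⋃ y ∈ s, bad y) ≤ ∑ y ∈ s, μ.real (bad y) := measureReal_biUnion_finset_le _ _
      _ ≤ ∑ y ∈ s, 2 * Real.exp (-(c / 64) * a ^ 2) := Finset.sum_le_sum fun y hy =>
          RealGrassmannian.measureReal_sum_projNormSq_le (by omega) hkd hV hind (hs1 y hy) hB
            hc0.le hc8 hcB ha0
      _ = s.card * (2 * Real.exp (-(c / 64) * a ^ 2)) := by simp
      _ ≤ Real.exp (2 * d) * (2 * Real.exp (-(c / 64) * (C ^ 2 * d + t ^ 2))) := by
          have h9 : (s.card : ℝ) ≤ Real.exp (2 * d) := le_trans (by exact_mod_cast hcard) h5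
          have h10 : -(c / 64) * a ^ 2 ≤ -(c / 64) * (C ^ 2 * d + t ^ 2) :=
            mul_le_mul_of_nonpos_left hsq (by linarith)
          gcongr
      _ = 2 * Real.exp (2 * d + -(c / 64) * (C ^ 2 * d + t ^ 2)) := by rw [Real.exp_add]; ring
      _ = _ := by
          congr 2
          linear_combination (-(d : ℝ)) * hC2
  have h1 : 1 ≤ μ.real good + μ.real (⋃ y ∈ s, bad y) := by
    rw [← probReal_univ (μ := μ)]
    exact (measureReal_mono hcover).trans (measureReal_union_le _ _)
  linarith
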